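/- Let $x_0,x_1,x_2,\dots$ be random samples with the same observed label $\tilde y\in\{1,\dots,k\}$, let $\mathcal C$ be the measurable map giving the true label, and let $g_j\in\mathbb R^m$ be the feature vector of $x_j$ under a measurable feature map, with $g_j\neq 0$ almost surely. For the group of the first $n$ samples let $A^{(n)}\in\mathbb R^{n\times n}$ be the affinity matrix with entries the cosine similarities $A^{(n)}_{jz}=a_{j,z}=\frac{g_z\cdot g_j}{\|g_z\|\,\|g_j\|}$. Fix two samples, a clean one $x_p$ ($\mathcal C(x_p)=\tilde y$ almost surely) and a noisy one $x_q$ ($\mathcal C(x_q)\neq\tilde y$ almost surely), and assume: 1. the affinities $a_{p,j}$, $j\notin\{p,q\}$, of the clean sample are i.i.d. with expectation $\mu_p$ and variance $\sigma_p^2>0$; 2. the affinities $a_{q,j}$, $j\notin\{p,q\}$, of the noisy sample are independent with expectation $\mu_q$ and satisfy Lyapunov's condition: with $B_n^2=\sum_{j<n,\,j\notin\{p,q\}}\operatorname{Var}(a_{q,j})$, which is positive for all large $n$, there is $\delta>0$ such that $B_n^{-(2+\delta)}\sum_{j<n,\,j\notin\{p,q\}}\mathbb E|a_{q,j}-\mu_q|^{2+\delta}\to0$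 as $n\to\infty$; 3. the clean sample is not submerged by the noisy one: for all large $n$, almost surely, $\sum_{j<n}a_{p,j}\ge\sum_{j<n}a_{q,j}$; 4. clean and noisy affinities have different distributions: for infinitely many $j$ the laws of $a_{p,j}$ and $a_{q,j}$ differ. Then, as $n\to\infty$, the mean $\frac1n\sum_{j<n}a_{p,j}$ of row $p$ of $A^{(n)}$ is asymptotically $N(\mu_p,\sigma_p^2/n)$ and the mean $\frac1n\sum_{j<n}a_{q,j}$ of row $q$ is asymptotically $N(\mu_q,B_n^2/n^2)$ (that is, after subtracting the mean and dividing by the standard deviation, each converges in distribution to $N(0,1)$); moreover $\mu_q<\mu_p$. -/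

import Mathlib

open MeasureTheory ProbabilityTheory Filter Topology

noncomputable section

namespace PairwiseSimilarity

/-- Cosine similarity of two feature vectors (used only for non-zero vectors). -/
def cosineSim {m : ℕ} (u v : EuclideanSpace ℝ (Fin m)) : ℝ :=
  inner ℝ u v / (‖u‖ * ‖v‖)

/-- The `n × n` affinity matrix of the group formed by the first `n` members of a sequence of
feature vectors: row `j` lists the cosine similarities of sample `j` with the samples of the
group. -/
def affinityMatrix {m : ℕ} (g : ℕ → EuclideanSpace ℝ (Fin m)) (n : ℕ) :
    Matrix (Fin n) (Fin n) ℝ :=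
  Matrix.of fun j z => cosineSim (g z) (g j)

/-- Sum of row `i` of an `n × n` matrix (with value `0` if there is no such row, `n ≤ i`). -/
def rowSum {n : ℕ} (A : Matrix (Fin n) (Fin n) ℝ) (i : ℕ) : ℝ :=
  if h : i < n then ∑ j, A ⟨i, h⟩ j else 0

/-- Mean value of row `i` of an `n × n` matrix. -/
def rowMean {n : ℕ} (A : Matrix (Fin n) (Fin n) ℝ) (i : ℕ) : ℝ :=
  rowSum A i / n

/-- The clean sample `p` is submerged by the noisy sample `q`: the affinities of `p` have a
smaller sum than those of `q`. -/
def Submerged {n : ℕ} (A : Matrix (Fin n) (Fin n) ℝ) (p q : ℕ) : Prop :=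
  rowSum A p < rowSum A q

/-- The members, other than `p` and `q`, of a group of `n` samples. -/
def others (p q n : ℕ) : Finset ℕ :=
  (Finset.range n).filter fun j => j ≠ p ∧ j ≠ q

section Random

variable {Ω : Type*} [MeasurableSpace Ω]

/-- The standard deviation `B_n` of the sum of the independent variables `a j`, `j ∈ s n`. -/
def totalStd (P : Measure Ω) (s : ℕ → Finset ℕ) (a : ℕ → Ω → ℝ) (n : ℕ) : ℝ :=
  √(∑ j ∈ s n, Var[a j; P])

/-- Lyapunov's condition for the variables `a j`, with partial sums over `j ∈ s n`: for some
`δ > 0`, the moments of order `2 + δ` are finite and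
`B_n ^ (-(2 + δ)) * ∑ j ∈ s n, E |a j - E (a j)| ^ (2 + δ)` tends to `0`. -/
def LyapunovCondition (P : Measure Ω) (s : ℕ → Finset ℕ) (a : ℕ → Ω → ℝ) : Prop :=
  ∃ δ : ℝ, 0 < δ ∧
    (∀ n, ∀ j ∈ s n, MemLp (a j) (ENNReal.ofReal (2 + δ)) P) ∧
    (∀ᶠ n in atTop, 0 < totalStd P s a n) ∧
    Tendsto (fun n => (∑ j ∈ s n, ∫ ω, |a j ω - ∫ ω', a j ω' ∂P| ^ (2 + δ) ∂P) /
      totalStd P s a n ^ (2 + δ)) atTop (𝓝 0)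

/-- The random variables `R n` are asymptotically Gaussian with mean `c` and standard deviation
`s n`, i.e. asymptotically `N(c, (s n)²)`: `(R n - c) / s n` converges in distribution to the
standard Gaussian law. -/
def IsAsymptoticallyGaussian (P : Measure Ω) [IsProbabilityMeasure P]
    (R : ℕ → Ω → ℝ) (c : ℝ) (s : ℕ → ℝ) : Prop :=
  (∀ᶠ n in atTop, 0 < s n) ∧
    TendstoInDistribution (fun n ω => (R n ω - c) / s n) atTop (id : ℝ → ℝ)
      (fun _ => P) (gaussianReal 0 1)

/-- The affinity of samples `i` and `j` as a random variable. -/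
def affinity {m : ℕ} (g : ℕ → Ω → EuclideanSpace ℝ (Fin m)) (i j : ℕ) (ω : Ω) : ℝ :=
  cosineSim (g j ω) (g i ω)

/-- Assumption on the affinities of the clean sample `p`: those with the samples other than
`p, q` are i.i.d. with expectation `μp` and variance `σp²`. -/
structure CleanAffinities {m : ℕ} (P : Measure Ω) (g : ℕ → Ω → EuclideanSpace ℝ (Fin m))
    (p q : ℕ) (μp σp : ℝ) : Prop where
  indep : iIndepFun (fun (j : {j : ℕ // j ≠ p ∧ j ≠ q}) => affinity g p j) P
  ident : ∀ j j' : {j : ℕ // j ≠ p ∧ j ≠ q},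
    IdentDistrib (affinity g p j) (affinity g p j') P P
  mean : ∀ j : {j : ℕ // j ≠ p ∧ j ≠ q}, ∫ ω, affinity g p j ω ∂P = μp
  variance : ∀ j : {j : ℕ // j ≠ p ∧ j ≠ q}, Var[affinity g p j; P] = σp ^ 2

/-- Assumption on the affinities of the noisy sample `q`: those with the samples other than
`p, q` are independent (not necessarily identically distributed) with expectation `μq`,
and satisfy Lyapunov's condition. -/
structure NoisyAffinities {m : ℕ} (P : Measure Ω) (g : ℕ → Ω → EuclideanSpace ℝ (Fin m))
    (p q : ℕ) (μq : ℝ) : Prop where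
  indep : iIndepFun (fun (j : {j : ℕ // j ≠ p ∧ j ≠ q}) => affinity g q j) P
  mean : ∀ j : {j : ℕ // j ≠ p ∧ j ≠ q}, ∫ ω, affinity g q j ω ∂P = μq
  lyapunov : LyapunovCondition P (others p q) (affinity g q)

end Random

end PairwiseSimilarity

end

/-!
The argument rests on the fact that affinities, being cosines, are bounded by `1`.

*Asymptotic normality.* For independent, centred and uniformly bounded variables, the
characteristic function of each term differs from that of the Gaussian law with the same variance
by at most a constant times the scale times the variance (`norm_charFun_sub_exp_le`). Multiplying
over the terms, a sum divided by `b n` is asymptotically standard Gaussian whenever `b` tends to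
infinity and `b n ^ 2` is equivalent to the variance of the sum
(`tendstoInDistribution_sum_div_of_bounded`, through Lévy's convergence theorem). This covers both
rows: for the clean sample `b n = σp * √n`, for the noisy one `b n` is the total standard deviation
`B_n`. Boundedness makes Lyapunov's condition automatic once `B_n` tends to infinity, and conversely
that is what Lyapunov's condition has to supply: it excludes a bounded `B_n`
(`PairwiseSimilarity.tendsto_totalStd_atTop`). The affinities with the samples `p` and `q`
themselves, on which nothing is assumed, disappear after division by `b n`.

*Comparison of the means.* Since the affinity matrix is symmetric with unit diagonal, the columns
`p` and `q` cancel in the difference of the two row sums. What remains is almost surely nonnegative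
with expectation `(n - 2) * (μp - μq)`, whence `μq ≤ μp`. In the case of equality a nonnegative
variable of zero expectation vanishes almost surely, for all large `n`; then so do the increments
`a p j - a q j`, and the two rows would eventually have equal laws
(`PairwiseSimilarity.mean_lt_mean_of_not_submerged`).
-/

/-! ### Characteristic functions of bounded centred variables -/

lemma norm_prod_sub_prod_le_sum {ι : Type*} (s : Finset ι) (f g : ι → ℂ)
    (hf : ∀ i, ‖f i‖ ≤ 1) (hg : ∀ i, ‖g i‖ ≤ 1) :
    ‖∏ i ∈ s, f i - ∏ i ∈ s, g i‖ ≤ ∑ i ∈ s, ‖f i - g i‖ := by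
  classical
  induction s using Finset.induction_on with
  | empty => simp
  | insert a s ha ih =>
    rw [Finset.prod_insert ha, Finset.prod_insert ha, Finset.sum_insert ha]
    have hs : ‖∏ i ∈ s, g i‖ ≤ 1 := by
      rw [norm_prod]
      exact Finset.prod_le_one (fun i _ => norm_nonneg _) (fun i _ => hg i)
    calc ‖f a * ∏ i ∈ s, f i - g a * ∏ i ∈ s, g i‖
        = ‖f a * (∏ i ∈ s, f i - ∏ i ∈ s, g i) + (f a - g a) * ∏ i ∈ s, g i‖ := by
          congr 1; ring
      _ ≤ ‖f a‖ * ‖∏ i ∈ s, f i - ∏ i ∈ s, g i‖ + ‖f a - g a‖ * ‖∏ i ∈ s, g i‖ := by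
          rw [← norm_mul, ← norm_mul]; exact norm_add_le _ _
      _ ≤ 1 * ∑ i ∈ s, ‖f i - g i‖ + ‖f a - g a‖ * 1 := by
          gcongr
          exact hf a
      _ = ‖f a - g a‖ + ∑ i ∈ s, ‖f i - g i‖ := by ring

section
variable {Ω : Type*} [MeasurableSpace Ω] {P : Measure Ω} [IsProbabilityMeasure P]

/-- The third-order Taylor bound for the characteristic function of a bounded centred variable. -/
lemma norm_charFun_sub_taylor_le {X : Ω → ℝ} (hX : Measurable X) {K : ℝ}
    (hK : ∀ ω, |X ω| ≤ K) (h0 : ∫ ω, X ω ∂P = 0) {u : ℝ} (hu : |u| * K ≤ 1) :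
    ‖charFun (P.map X) u - ((1 - u ^ 2 * Var[X; P] / 2 : ℝ) : ℂ)‖ ≤
      |u| ^ 3 * K * Var[X; P] := by
  have hint : Integrable X P :=
    Integrable.of_bound hX.aestronglyMeasurable K (ae_of_all _ fun ω => by simpa using hK ω)
  have hint2 : Integrable (fun ω => X ω ^ 2) P :=
    Integrable.of_bound (by fun_prop) (K ^ 2) (ae_of_all _ fun ω => by
      simpa using sq_le_sq' (by linarith [abs_le.1 (hK ω)]) (abs_le.1 (hK ω)).2)
  have hvar : Var[X; P] = ∫ ω, X ω ^ 2 ∂P := by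
    rw [variance_eq_integral hX.aemeasurable, h0]; simp
  have hexp : Integrable (fun ω => Complex.exp (u * X ω * Complex.I)) P :=
    Integrable.of_bound (by fun_prop) 1 (ae_of_all _ fun ω => by
      rw [← Complex.ofReal_mul, Complex.norm_exp_ofReal_mul_I])
  have htay : ∫ ω, ((1 - u ^ 2 / 2 * X ω ^ 2 : ℝ) + ((u * X ω : ℝ) : ℂ) * Complex.I) ∂P
      = ((1 - u ^ 2 * Var[X; P] / 2 : ℝ) : ℂ) := by
    have h1 : ∫ ω, (1 - u ^ 2 / 2 * X ω ^ 2) ∂P = 1 - u ^ 2 * Var[X; P] / 2 := by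
      rw [integral_sub (integrable_const _) (hint2.const_mul _), integral_const_mul, hvar]
      simp; ring
    have h2 : ∫ ω, u * X ω ∂P = 0 := by rw [integral_const_mul, h0, mul_zero]
    rw [integral_add, integral_mul_const, integral_complex_ofReal, integral_complex_ofReal, h1, h2]
    · simp
    · exact ((integrable_const _).sub (hint2.const_mul _)).ofReal
    · exact (hint.const_mul u).ofReal.mul_const _
  rw [charFun_apply_real, integral_map hX.aemeasurable (by fun_prop), ← htay,
    ← integral_sub hexp]
  · calc _ ≤ ∫ ω, |u| ^ 3 * K * X ω ^ 2 ∂P := by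
          refine norm_integral_le_of_norm_le (hint2.const_mul _) (ae_of_all _ fun ω => ?_)
          have hz : ‖((u * X ω : ℝ) : ℂ) * Complex.I‖ = |u| * |X ω| := by simp
          have hz1 : |u| * |X ω| ≤ 1 :=
            (mul_le_mul_of_nonneg_left (hK ω) (abs_nonneg u)).trans hu
          have := Complex.exp_bound (x := ((u * X ω : ℝ) : ℂ) * Complex.I) (n := 3)
            (by rw [hz]; exact hz1) (by norm_num)
          rw [hz] at this
          have hsum : ∑ m ∈ Finset.range 3,
              (((u * X ω : ℝ) : ℂ) * Complex.I) ^ m / (m.factorial : ℂ) =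
              ((1 - u ^ 2 / 2 * X ω ^ 2 : ℝ) + ((u * X ω : ℝ) : ℂ) * Complex.I) := by
            simp only [Finset.sum_range_succ, Finset.sum_range_zero, mul_pow, Complex.I_sq]
            push_cast
            simp [Nat.factorial]
            ring
          rw [hsum] at this
          push_cast at this ⊢
          refine this.trans ?_
          have h3 : |X ω| ^ 3 ≤ K * X ω ^ 2 := by
            rw [← sq_abs (X ω), pow_succ, mul_comm]
            exact mul_le_mul_of_nonneg_right (hK ω) (by positivity)
          norm_num [Nat.factorial]
          rw [mul_pow]
          have h4 : |u| ^ 3 * |X ω| ^ 3 ≤ |u| ^ 3 * (K * X ω ^ 2) := by gcongr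
          nlinarith [show 0 ≤ |u| ^ 3 * |X ω| ^ 3 by positivity]
      _ = _ := by rw [integral_const_mul, hvar]
  · exact (((integrable_const _).sub (hint2.const_mul _)).ofReal).add
      ((hint.const_mul u).ofReal.mul_const _)

/-- A bounded centred variable has nearly the characteristic function of the Gaussian law with the
same variance, with an error proportional to the variance, so that the errors can be added up over
the terms of a sum. -/
lemma norm_charFun_sub_exp_le {X : Ω → ℝ} (hX : Measurable X) {K : ℝ}
    (hK : ∀ ω, |X ω| ≤ K) (h0 : ∫ ω, X ω ∂P = 0) {u : ℝ} (hu : |u| * K ≤ 1) :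
    ‖charFun (P.map X) u - ((Real.exp (-(u ^ 2 * Var[X; P] / 2)) : ℝ) : ℂ)‖ ≤
      2 * |u| ^ 3 * K * Var[X; P] := by
  obtain ⟨ω₀⟩ : Nonempty Ω := nonempty_of_isProbabilityMeasure P
  have hK0 : 0 ≤ K := (abs_nonneg _).trans (hK ω₀)
  have hv0 : 0 ≤ Var[X; P] := variance_nonneg _ _
  have hvK : Var[X; P] ≤ K ^ 2 := by
    have := variance_le_sq_of_bounded (μ := P) (a := -K) (b := K) (X := X)
      (ae_of_all _ fun ω => abs_le.1 (hK ω)) hX.aemeasurable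
    refine this.trans (le_of_eq ?_); ring
  set v := Var[X; P]
  have huv : |u| ^ 2 * v ≤ |u| * K := by
    calc |u| ^ 2 * v ≤ |u| ^ 2 * K ^ 2 := by gcongr
      _ = (|u| * K) * (|u| * K) := by ring
      _ ≤ 1 * (|u| * K) := by gcongr
      _ = |u| * K := one_mul _
  have hw0 : 0 ≤ |u| ^ 2 * v := by positivity
  -- `|exp (-w) - (1 - w)| ≤ w ^ 2` for `w = u ^ 2 * v / 2`, and `|u| ^ 2 * v ≤ |u| * K`.
  have h1 : ‖((1 - u ^ 2 * v / 2 : ℝ) : ℂ) - ((Real.exp (-(u ^ 2 * v / 2)) : ℝ) : ℂ)‖ ≤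
      |u| ^ 3 * K * v := by
    rw [← Complex.ofReal_sub, Complex.norm_real, Real.norm_eq_abs, abs_sub_comm]
    have := Real.abs_exp_sub_one_sub_id_le (x := -(u ^ 2 * v / 2)) (by
      rw [← sq_abs u, abs_neg, abs_of_nonneg (by positivity)]; linarith)
    calc |Real.exp (-(u ^ 2 * v / 2)) - (1 - u ^ 2 * v / 2)|
        = |Real.exp (-(u ^ 2 * v / 2)) - 1 - -(u ^ 2 * v / 2)| := by congr 1; ring
      _ ≤ (-(u ^ 2 * v / 2)) ^ 2 := this
      _ = (|u| ^ 2 * v) * (|u| ^ 2 * v) / 4 := by rw [← sq_abs u]; ring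
      _ ≤ (|u| * K) * (|u| ^ 2 * v) := by nlinarith
      _ = |u| ^ 3 * K * v := by ring
  calc _ ≤ _ := norm_sub_le_norm_sub_add_norm_sub _ ((1 - u ^ 2 * v / 2 : ℝ) : ℂ) _
    _ ≤ |u| ^ 3 * K * v + |u| ^ 3 * K * v :=
      add_le_add (norm_charFun_sub_taylor_le hX hK h0 hu) h1
    _ = _ := by ring

/-! ### The central limit theorem for bounded variables -/

/-- **Central limit theorem** for sums of independent, centred, uniformly bounded variables: if `b`
tends to infinity and `b n ^ 2` is equivalent to the variance of the sum over `s n`, then that sum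
divided by `b n` converges in distribution to the standard Gaussian law. The variables need not be
identically distributed, and the finite sets `s n` are arbitrary. -/
theorem tendstoInDistribution_sum_div_of_bounded {ι : Type*} {X : ι → Ω → ℝ}
    (hX : ∀ i, Measurable (X i)) (hindep : iIndepFun X P) {K : ℝ} (hK : ∀ i ω, |X i ω| ≤ K)
    (h0 : ∀ i, ∫ ω, X i ω ∂P = 0) (s : ℕ → Finset ι) {b : ℕ → ℝ} (hb : Tendsto b atTop atTop)
    (hvar : Tendsto (fun n => (∑ i ∈ s n, Var[X i; P]) / b n ^ 2) atTop (𝓝 1)) :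
    TendstoInDistribution (fun n ω => (∑ i ∈ s n, X i ω) / b n) atTop (id : ℝ → ℝ)
      (fun _ => P) (gaussianReal 0 1) where
  forall_aemeasurable n := by fun_prop
  tendsto := by
    refine ProbabilityMeasure.tendsto_iff_tendsto_charFun.2 fun t => ?_
    have hchar (n : ℕ) : charFun (P.map fun ω => (∑ i ∈ s n, X i ω) / b n) t =
        ∏ i ∈ s n, charFun (P.map (X i)) ((b n)⁻¹ * t) := by
      simp_rw [div_eq_inv_mul]
      rw [charFun_map_mul_comp (by fun_prop),
        (hindep.restrict (s n)).charFun_map_fun_finsetSum_eq_prod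
          (fun i _ => (hX i).aemeasurable), Finset.prod_apply]
    have hgauss : Tendsto (fun n => ∏ i ∈ s n,
        ((Real.exp (-(((b n)⁻¹ * t) ^ 2 * Var[X i; P] / 2)) : ℝ) : ℂ)) atTop
        (𝓝 (charFun (gaussianReal 0 1) t)) := by
      have h1 : charFun (gaussianReal 0 1) t = ((Real.exp (-(t ^ 2 / 2 * 1)) : ℝ) : ℂ) := by
        rw [charFun_gaussianReal]; push_cast; congr 1; simp
      rw [h1]
      have h2 := (Real.continuous_exp.tendsto _).comp (hvar.const_mul (t ^ 2 / 2)).neg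
      refine ((Complex.continuous_ofReal.tendsto _).comp h2).congr fun n => ?_
      rw [← Complex.ofReal_prod, ← Real.exp_sum]
      simp only [Function.comp]
      congr 2
      rw [Finset.sum_neg_distrib, neg_inj, ← Finset.sum_div, ← Finset.mul_sum]
      ring
    have hdiff : Tendsto (fun n => ∏ i ∈ s n, charFun (P.map (X i)) ((b n)⁻¹ * t) -
        ∏ i ∈ s n, ((Real.exp (-(((b n)⁻¹ * t) ^ 2 * Var[X i; P] / 2)) : ℝ) : ℂ))
        atTop (𝓝 0) := by
      have hbinv : Tendsto (fun n => (b n)⁻¹) atTop (𝓝 0) := tendsto_inv_atTop_zero.comp hb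
      have hlim : Tendsto (fun n => 2 * |t| ^ 3 * K *
          ((b n)⁻¹ * ((∑ i ∈ s n, Var[X i; P]) / b n ^ 2))) atTop (𝓝 0) := by
        simpa using (hbinv.mul hvar).const_mul (2 * |t| ^ 3 * K)
      have hsmall : ∀ᶠ n in atTop, |(b n)⁻¹ * t| * K < 1 := by
        have : Tendsto (fun n => |(b n)⁻¹ * t| * K) atTop (𝓝 0) := by
          simpa using ((hbinv.mul_const t).abs).mul_const K
        exact this.eventually_lt_const one_pos
      refine squeeze_zero_norm' ?_ hlim
      filter_upwards [hsmall, hb.eventually_gt_atTop 0] with n hn hbn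
      calc _ ≤ ∑ i ∈ s n, 2 * |(b n)⁻¹ * t| ^ 3 * K * Var[X i; P] := by
            refine (norm_prod_sub_prod_le_sum _ _ _ (fun i => ?_) (fun i => ?_)).trans
              (Finset.sum_le_sum fun i _ =>
                norm_charFun_sub_exp_le (hX i) (hK i) (h0 i) hn.le)
            · have := Measure.isProbabilityMeasure_map (μ := P) (hX i).aemeasurable
              exact norm_charFun_le_one _
            · rw [Complex.norm_real, Real.norm_eq_abs, Real.abs_exp, Real.exp_le_one_iff,
                neg_nonpos]
              have := variance_nonneg (X i) P
              positivity
        _ = _ := by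
            rw [← Finset.mul_sum, abs_mul, abs_of_pos (inv_pos.2 hbn)]
            field_simp
    have := hdiff.add hgauss
    simp only [sub_add_cancel, zero_add] at this
    simpa [hchar] using this
end

namespace PairwiseSimilarity

/-! ### Affinities and row sums -/

lemma others_mono (p q : ℕ) : Monotone (others p q) := fun _ _ h =>
  Finset.filter_subset_filter _ (Finset.range_mono h)

lemma sum_range_eq_sum_others_add {M : Type*} [AddCommMonoid M] {p q n : ℕ} (hpq : p ≠ q)
    (hp : p < n) (hq : q < n) (f : ℕ → M) :
    ∑ j ∈ Finset.range n, f j = ∑ j ∈ others p q n, f j + (f p + f q) := by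
  rw [← Finset.sum_filter_add_sum_filter_not (Finset.range n) (fun j => j ≠ p ∧ j ≠ q),
    ← Finset.sum_pair hpq]
  congr 2
  ext j
  simp only [Finset.mem_filter, Finset.mem_range, Finset.mem_insert, Finset.mem_singleton]
  omega

lemma card_others {p q n : ℕ} (hpq : p ≠ q) (hp : p < n) (hq : q < n) :
    ((others p q n).card : ℝ) = n - 2 := by
  have := sum_range_eq_sum_others_add hpq hp hq fun _ => (1 : ℝ)
  simp only [Finset.sum_const, Finset.card_range, nsmul_eq_mul, mul_one] at this
  linarith

section

variable {Ω : Type*} {m : ℕ} {g : ℕ → Ω → EuclideanSpace ℝ (Fin m)}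

lemma abs_affinity_le_one (i j : ℕ) (ω : Ω) : |affinity g i j ω| ≤ 1 :=
  abs_real_inner_div_norm_mul_norm_le_one _ _

lemma affinity_comm (i j : ℕ) (ω : Ω) : affinity g i j ω = affinity g j i ω := by
  rw [affinity, affinity, cosineSim, cosineSim, real_inner_comm, mul_comm ‖g j ω‖]

lemma affinity_self {i : ℕ} {ω : Ω} (h : g i ω ≠ 0) : affinity g i i ω = 1 := by
  have := norm_ne_zero_iff.2 h
  rw [affinity, cosineSim, real_inner_self_eq_norm_mul_norm]
  field_simp

lemma rowSum_affinityMatrix {i n : ℕ} (h : i < n) (ω : Ω) :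
    rowSum (affinityMatrix (fun j => g j ω) n) i = ∑ j ∈ Finset.range n, affinity g i j ω := by
  rw [rowSum, dif_pos h, ← Fin.sum_univ_eq_sum_range (fun j => affinity g i j ω)]
  rfl

variable [MeasurableSpace Ω] {P : Measure Ω}

lemma measurable_affinity (hg : ∀ j, Measurable (g j)) (i j : ℕ) :
    Measurable (affinity g i j) := by
  have hi := hg i
  have hj := hg j
  unfold affinity cosineSim
  fun_prop

lemma integrable_affinity [IsFiniteMeasure P] (hg : ∀ j, Measurable (g j)) (i j : ℕ) :
    Integrable (affinity g i j) P :=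
  Integrable.of_bound (measurable_affinity hg i j).aestronglyMeasurable 1
    (ae_of_all _ fun ω => abs_affinity_le_one i j ω)

lemma measurable_rowSum_affinityMatrix (hg : ∀ j, Measurable (g j)) (i n : ℕ) :
    Measurable fun ω => rowSum (affinityMatrix (fun j => g j ω) n) i := by
  by_cases h : i < n
  · simp_rw [rowSum_affinityMatrix h]
    exact Finset.measurable_fun_sum _ fun j _ => measurable_affinity hg i j
  · simp only [rowSum, dif_neg h]
    exact measurable_const

/-! ### Total variance under Lyapunov's condition -/

/-- Lyapunov's condition forces the total variance to infinity: if it stayed bounded, the sums of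
`2 + δ` moments, which are nondecreasing, would tend to `0`, hence vanish, and all variables would
be almost surely constant. -/
lemma tendsto_totalStd_atTop [IsProbabilityMeasure P] {s : ℕ → Finset ℕ} (hs : Monotone s)
    {a : ℕ → Ω → ℝ} (h : LyapunovCondition P s a) : Tendsto (totalStd P s a) atTop atTop := by
  obtain ⟨δ, hδ, hmem, hpos, hlim⟩ := h
  have hv : Monotone fun n => ∑ j ∈ s n, Var[a j; P] := fun m n hmn =>
    Finset.sum_le_sum_of_subset_of_nonneg (hs hmn) fun _ _ _ => variance_nonneg _ _
  rcases tendsto_atTop_of_monotone hv with htop | ⟨l, hl⟩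
  · exact Real.tendsto_sqrt_atTop.comp htop
  exfalso
  set N : ℕ → ℝ := fun n => ∑ j ∈ s n, ∫ ω, |a j ω - ∫ ω', a j ω' ∂P| ^ (2 + δ) ∂P
  have hterm (j : ℕ) : 0 ≤ ∫ ω, |a j ω - ∫ ω', a j ω' ∂P| ^ (2 + δ) ∂P :=
    integral_nonneg fun ω => by positivity
  have hNmono : Monotone N := fun m n hmn =>
    Finset.sum_le_sum_of_subset_of_nonneg (hs hmn) fun j _ _ => hterm j
  have hN0 : Tendsto N atTop (𝓝 0) := by
    have h1 : Tendsto (fun n => totalStd P s a n ^ (2 + δ)) atTop (𝓝 (√l ^ (2 + δ))) :=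
      ((Real.continuous_sqrt.tendsto l).comp hl).rpow_const (Or.inr (by positivity))
    have h2 := hlim.mul h1
    rw [zero_mul] at h2
    refine h2.congr' ?_
    filter_upwards [hpos] with n hn
    exact div_mul_cancel₀ _ (Real.rpow_pos_of_pos hn _).ne'
  obtain ⟨n, hn⟩ := hpos.exists
  have hNn : N n = 0 :=
    le_antisymm (hNmono.ge_of_tendsto hN0 n) (Finset.sum_nonneg fun j _ => hterm j)
  refine hn.ne' ?_
  rw [totalStd, Finset.sum_eq_zero, Real.sqrt_zero]
  intro j hj
  have hj0 := (Finset.sum_eq_zero_iff_of_nonneg fun j _ => hterm j).1 hNn j hj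
  have hint : Integrable (fun ω => |a j ω - ∫ ω', a j ω' ∂P| ^ (2 + δ)) P := by
    have := ((hmem n j hj).sub (memLp_const (∫ ω', a j ω' ∂P))).integrable_norm_rpow
      (by simp; linarith) (by simp)
    rwa [ENNReal.toReal_ofReal (by positivity)] at this
  have hae := (integral_eq_zero_iff_of_nonneg (fun ω => by positivity) hint).1 hj0
  have hconst : a j =ᵐ[P] fun _ => ∫ ω', a j ω' ∂P := by
    filter_upwards [hae] with ω hω
    have h3 := (Real.rpow_eq_zero (abs_nonneg _) (by positivity)).1 hω
    exact sub_eq_zero.1 (abs_eq_zero.1 h3)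
  rw [variance_congr hconst]
  simp [variance_eq_integral]

/-! ### Asymptotics and comparison of row means -/

/-- A row mean is asymptotically Gaussian as soon as `b` tends to infinity and `b n ^ 2` is
equivalent to the total variance of the entries outside the columns `p` and `q`; the two remaining
entries are bounded, hence negligible against `b n`. -/
theorem isAsymptoticallyGaussian_rowMean [IsProbabilityMeasure P] (hg : ∀ j, Measurable (g j))
    {p q : ℕ} (hpq : p ≠ q) (i : ℕ) {μ : ℝ}
    (hindep : iIndepFun (fun (j : {j : ℕ // j ≠ p ∧ j ≠ q}) => affinity g i j) P)
    (hmean : ∀ j : {j : ℕ // j ≠ p ∧ j ≠ q}, ∫ ω, affinity g i j ω ∂P = μ)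
    {b : ℕ → ℝ} (hb : Tendsto b atTop atTop)
    (hvar : Tendsto (fun n => (∑ j ∈ others p q n, Var[affinity g i j; P]) / b n ^ 2)
      atTop (𝓝 1)) :
    IsAsymptoticallyGaussian P (fun n ω => rowMean (affinityMatrix (fun j => g j ω) n) i) μ
      (fun n => b n / n) := by
  have hmeas := measurable_affinity hg
  refine ⟨?_, ?_⟩
  · filter_upwards [hb.eventually_gt_atTop 0, eventually_gt_atTop 0] with n hn hn0
    positivity
  have hclt := tendstoInDistribution_sum_div_of_bounded (P := P)
    (X := fun (j : {j : ℕ // j ≠ p ∧ j ≠ q}) ω => affinity g i j ω - μ) (K := 1 + |μ|)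
    (fun j => (hmeas i j).sub_const μ)
    (hindep.comp (fun _ x => x - μ) fun _ => by fun_prop)
    (fun j ω => (abs_sub _ _).trans (by gcongr; exact abs_affinity_le_one i j ω))
    (fun j => by rw [integral_sub (integrable_affinity hg i j) (integrable_const _), hmean j]; simp)
    (fun n => (Finset.range n).subtype fun j => j ≠ p ∧ j ≠ q) hb ?_
  · refine tendstoInDistribution_of_tendstoInMeasure_sub _ _ hclt ?_ fun n => ?_
    · rw [tendstoInMeasure_iff_norm]
      intro ε hε
      refine tendsto_const_nhds.congr' ?_
      have hsmall : Tendsto (fun n => 2 * (1 + |μ|) * (b n)⁻¹) atTop (𝓝 0) := by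
        simpa using (tendsto_inv_atTop_zero.comp hb).const_mul (2 * (1 + |μ|))
      filter_upwards [hb.eventually_gt_atTop 0, eventually_gt_atTop p, eventually_gt_atTop q,
        eventually_gt_atTop i, hsmall.eventually_lt_const hε] with n hbn hpn hqn hin hn
      refine (measure_mono_null (t := ∅) (fun ω hω => ?_) measure_empty).symm
      have hn0 : (n : ℝ) ≠ 0 := Nat.cast_ne_zero.2 (by omega)
      have hsum : ∑ j ∈ (Finset.range n).subtype (fun j => j ≠ p ∧ j ≠ q),
          (affinity g i j ω - μ) = ∑ j ∈ others p q n, (affinity g i j ω - μ) :=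
        Finset.sum_subtype_eq_sum_filter (fun j => affinity g i j ω - μ)
      have hrow : ∑ j ∈ Finset.range n, affinity g i j ω - n * μ =
          ∑ j ∈ others p q n, (affinity g i j ω - μ) +
            ((affinity g i p ω - μ) + (affinity g i q ω - μ)) := by
        rw [← sum_range_eq_sum_others_add hpq hpn hqn (fun j => affinity g i j ω - μ)]
        simp
      have hdiff : (rowMean (affinityMatrix (fun j => g j ω) n) i - μ) / (b n / n) -
          (∑ j ∈ (Finset.range n).subtype (fun j => j ≠ p ∧ j ≠ q),
            (affinity g i j ω - μ)) / b n =
          ((affinity g i p ω - μ) + (affinity g i q ω - μ)) * (b n)⁻¹ := by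
        rw [hsum, rowMean, rowSum_affinityMatrix hin]
        field_simp
        linarith
      have hle (j : ℕ) : |affinity g i j ω - μ| ≤ 1 + |μ| :=
        (abs_sub _ _).trans (by gcongr; exact abs_affinity_le_one i j ω)
      simp only [Set.mem_ofPred_eq, Pi.sub_apply, Pi.zero_apply, sub_zero] at hω
      rw [hdiff, norm_mul, Real.norm_eq_abs, Real.norm_eq_abs, abs_of_pos (inv_pos.2 hbn)] at hω
      refine absurd (hω.trans (mul_le_mul_of_nonneg_right ((abs_add_le _ _).trans
        (add_le_add (hle p) (hle q))) (inv_pos.2 hbn).le)) ?_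
      linarith
    · have := measurable_rowSum_affinityMatrix hg i n
      exact (((this.div_const (n : ℝ)).sub_const μ).div_const (b n / n)).aemeasurable
  · refine hvar.congr fun n => ?_
    congr 1
    rw [others, ← Finset.sum_subtype_eq_sum_filter]
    exact Finset.sum_congr rfl fun j _ =>
      (variance_sub_const (hmeas i j).aestronglyMeasurable _).symm

/-- In the difference of the rows `p` and `q` the columns `p` and `q` cancel, because the affinity
matrix is symmetric with diagonal entries `1`. The rest of the difference is nonnegative; if its
expectation were nonpositive it would vanish almost surely in every large group, and so would its
increments, making the two rows eventually equal in law. -/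
theorem mean_lt_mean_of_not_submerged [IsProbabilityMeasure P] (hg : ∀ j, Measurable (g j))
    (hne : ∀ j, ∀ᵐ ω ∂P, g j ω ≠ 0) {p q : ℕ} (hpq : p ≠ q) {μp μq : ℝ}
    (hmp : ∀ j : {j : ℕ // j ≠ p ∧ j ≠ q}, ∫ ω, affinity g p j ω ∂P = μp)
    (hmq : ∀ j : {j : ℕ // j ≠ p ∧ j ≠ q}, ∫ ω, affinity g q j ω ∂P = μq)
    (hsub : ∀ᶠ n in atTop, ∀ᵐ ω ∂P,
      ¬ Submerged (affinityMatrix (fun j => g j ω) n) p q)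
    (hdiff : ∃ᶠ j in atTop, P.map (affinity g p j) ≠ P.map (affinity g q j)) :
    μq < μp := by
  have hint := integrable_affinity (P := P) hg
  set D : ℕ → Ω → ℝ := fun n ω => ∑ j ∈ others p q n, (affinity g p j ω - affinity g q j ω)
  have hDint (n : ℕ) : Integrable (D n) P :=
    integrable_finsetSum _ fun j _ => (hint p j).sub (hint q j)
  have hDmean (n : ℕ) : ∫ ω, D n ω ∂P = (others p q n).card * (μp - μq) := by
    have hj (j : ℕ) (hj : j ∈ others p q n) :
        ∫ ω, (affinity g p j ω - affinity g q j ω) ∂P = μp - μq := by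
      have hj' : j ≠ p ∧ j ≠ q := (Finset.mem_filter.1 hj).2
      rw [integral_sub (hint p j) (hint q j), hmp ⟨j, hj'⟩, hmq ⟨j, hj'⟩]
    simp only [D]
    rw [integral_finsetSum (f := fun j ω => affinity g p j ω - affinity g q j ω) _
      fun j _ => (hint p j).sub (hint q j), Finset.sum_congr rfl hj, Finset.sum_const,
      nsmul_eq_mul]
  -- The columns `p` and `q` contribute `1 + a p q` to both row sums.
  have hDnonneg : ∀ᶠ n in atTop, 0 ≤ᵐ[P] D n := by
    filter_upwards [hsub, eventually_gt_atTop p, eventually_gt_atTop q] with n hn hpn hqn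
    filter_upwards [hn, hne p, hne q] with ω hω hp0 hq0
    rw [Submerged, not_lt, rowSum_affinityMatrix hpn, rowSum_affinityMatrix hqn,
      sum_range_eq_sum_others_add hpq hpn hqn, sum_range_eq_sum_others_add hpq hpn hqn,
      affinity_self hp0, affinity_self hq0, affinity_comm q p] at hω
    simp only [D, Finset.sum_sub_distrib, Pi.zero_apply]
    linarith
  -- If `μp ≤ μq`, the nonnegative `D n` has nonpositive expectation, so it vanishes.
  by_contra! hle
  have hDzero : ∀ᶠ n in atTop, D n =ᵐ[P] 0 := by
    filter_upwards [hDnonneg] with n hn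
    refine (integral_eq_zero_iff_of_nonneg_ae hn (hDint n)).1
      (le_antisymm ?_ (integral_nonneg_of_ae hn))
    rw [hDmean]
    exact mul_nonpos_of_nonneg_of_nonpos (Nat.cast_nonneg _) (by linarith)
  have hlaw : ∀ᶠ j in atTop, P.map (affinity g p j) = P.map (affinity g q j) := by
    filter_upwards [hDzero, (tendsto_add_atTop_nat 1).eventually hDzero, eventually_gt_atTop p,
      eventually_gt_atTop q] with j hj hj1 hpj hqj
    refine Measure.map_congr ?_
    filter_upwards [hj, hj1] with ω hω hω1
    have hstep : D (j + 1) ω = (affinity g p j ω - affinity g q j ω) + D j ω := by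
      simp only [D]
      rw [others, Finset.range_add_one, Finset.filter_insert, if_pos ⟨hpj.ne', hqj.ne'⟩,
        Finset.sum_insert (by simp)]
      rfl
    rw [hω1, hω] at hstep
    simp only [Pi.zero_apply] at hstep
    linarith
  obtain ⟨j, hj, hj'⟩ := (hdiff.and_eventually hlaw).exists
  exact hj hj'

end

end PairwiseSimilarity

/-! ### Asymptotic laws of the clean and the noisy row -/

theorem theorem1
    {Ω : Type*} [MeasurableSpace Ω] (P : Measure Ω) [IsProbabilityMeasure P]
    -- instance space, the `k` labels, the true labelling, and the feature map into `ℝ^m`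
    {X : Type*} [MeasurableSpace X] {k m : ℕ}
    (C : X → Fin k) (_hC : Measurable C)
    (feature : X → EuclideanSpace ℝ (Fin m)) (hfeature : Measurable feature)
    -- the samples `x 0, x 1, …` of the group of observed label `y`
    (y : Fin k) (x : ℕ → Ω → X) (hx : ∀ j, Measurable (x j))
    (hne : ∀ j, ∀ᵐ ω ∂P, feature (x j ω) ≠ 0)
    -- the two selected samples: `x p` is clean, `x q` is noisy
    (p q : ℕ)
    (hp : ∀ᵐ ω ∂P, C (x p ω) = y) (hq : ∀ᵐ ω ∂P, C (x q ω) ≠ y)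
    -- clean affinities are i.i.d., noisy ones are independent and satisfy Lyapunov's condition
    (μp σp μq : ℝ) (hσp : 0 < σp)
    (hclean : PairwiseSimilarity.CleanAffinities P (fun j ω => feature (x j ω)) p q μp σp)
    (hnoisy : PairwiseSimilarity.NoisyAffinities P (fun j ω => feature (x j ω)) p q μq)
    -- in all large groups, the clean sample is almost surely not submerged by the noisy one
    (hsub : ∀ᶠ n in atTop, ∀ᵐ ω ∂P,
      ¬ PairwiseSimilarity.Submerged
        (PairwiseSimilarity.affinityMatrix (fun j => feature (x j ω)) n) p q)
    -- clean and noisy affinities obey different distributions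
    (hdiff : ∃ᶠ j in atTop,
      P.map (PairwiseSimilarity.affinity (fun j ω => feature (x j ω)) p j) ≠
        P.map (PairwiseSimilarity.affinity (fun j ω => feature (x j ω)) q j)) :
    PairwiseSimilarity.IsAsymptoticallyGaussian P
      (fun n ω => PairwiseSimilarity.rowMean
        (PairwiseSimilarity.affinityMatrix (fun j => feature (x j ω)) n) p)
      μp (fun n => σp / √(n : ℝ)) ∧
    PairwiseSimilarity.IsAsymptoticallyGaussian P
      (fun n ω => PairwiseSimilarity.rowMean
        (PairwiseSimilarity.affinityMatrix (fun j => feature (x j ω)) n) q)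
      μq (fun n => PairwiseSimilarity.totalStd P (PairwiseSimilarity.others p q)
        (PairwiseSimilarity.affinity (fun j ω => feature (x j ω)) q) n / n) ∧
    μq < μp := by

  have hg : ∀ j, Measurable fun ω => feature (x j ω) := fun j => hfeature.comp (hx j)
  have hpq : p ≠ q := by
    rintro rfl
    obtain ⟨ω, hω, hω'⟩ := (hp.and hq).exists
    exact hω' hω
  refine ⟨?_, ?_, PairwiseSimilarity.mean_lt_mean_of_not_submerged hg hne hpq hclean.mean
    hnoisy.mean hsub hdiff⟩
  -- With `b n = σp * √n` one has `b n / n = σp / √n`, and the total variance `(n - 2) * σp ^ 2` is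
  -- equivalent to `b n ^ 2`.
  · have hb : Tendsto (fun n : ℕ => σp * √(n : ℝ)) atTop atTop :=
      (Real.tendsto_sqrt_atTop.comp tendsto_natCast_atTop_atTop).const_mul_atTop hσp
    have hvar : Tendsto (fun n : ℕ => (∑ j ∈ PairwiseSimilarity.others p q n,
        Var[PairwiseSimilarity.affinity (fun j ω => feature (x j ω)) p j; P]) /
          (σp * √(n : ℝ)) ^ 2) atTop (𝓝 1) := by
      have hlim : Tendsto (fun n : ℕ => 1 - 2 * (n : ℝ)⁻¹) atTop (𝓝 1) := by
        simpa using (tendsto_inv_atTop_nhds_zero_nat (𝕜 := ℝ)).const_mul 2 |>.const_sub 1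
      refine hlim.congr' ?_
      filter_upwards [eventually_gt_atTop p, eventually_gt_atTop q] with n hpn hqn
      have hn0 : (n : ℝ) ≠ 0 := Nat.cast_ne_zero.2 (by omega)
      have hvj (j : ℕ) (hj : j ∈ PairwiseSimilarity.others p q n) :
          Var[PairwiseSimilarity.affinity (fun j ω => feature (x j ω)) p j; P] = σp ^ 2 :=
        hclean.variance ⟨j, (Finset.mem_filter.1 hj).2⟩
      rw [Finset.sum_congr rfl hvj, Finset.sum_const, nsmul_eq_mul,
        PairwiseSimilarity.card_others hpq hpn hqn, mul_pow,
        Real.sq_sqrt (Nat.cast_nonneg n)]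
      field_simp
    convert PairwiseSimilarity.isAsymptoticallyGaussian_rowMean hg hpq p hclean.indep hclean.mean
      hb hvar using 2 with n
    rw [mul_div_assoc, Real.sqrt_div_self, div_eq_mul_inv]
  · have hb := PairwiseSimilarity.tendsto_totalStd_atTop
      (PairwiseSimilarity.others_mono p q) hnoisy.lyapunov
    refine PairwiseSimilarity.isAsymptoticallyGaussian_rowMean hg hpq q hnoisy.indep hnoisy.mean
      hb (tendsto_const_nhds.congr' ?_)
    filter_upwards [hb.eventually_gt_atTop 0] with n hn
    rw [PairwiseSimilarity.totalStd, Real.sq_sqrt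
      (Finset.sum_nonneg fun j _ => variance_nonneg _ _), div_self]
    exact (Real.sqrt_pos.1 hn).ne'
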